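/- Let $\ln$ be the natural logarithm. For $b_1\ge\dots\ge b_d>0$ let $E_b=\{x\in\mathbb{R}^d:\sum_{i=1}^d x_i^2/b_i^2\le 1\}$ be the ellipsoid with semi-axes $b_1,\dots,b_d$, and let $\mathcal{H}_1(E_b)$, its unit entropy, be the natural logarithm of the minimal number of closed Euclidean balls of radius $1$, with centres in $\mathbb{R}^d$, that cover $E_b$. Put $K_b=\sum_{i:\,b_i>1}\ln b_i$ and $m_b=\#\{i: b_i>1\}$. There is a universal constant $c>0$ such that, for every $d\ge 2$ and all $b_1\ge\dots\ge b_d>0$, $$\mathcal{H}_1(E_b)\le K_b+c\left[\ln d+\sqrt{\ln(b_1)\,m_b\,\ln d}\right].$$ (If $b_1\le 1$ then $m_b=0$ and the square root is $0$.) -/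

import Mathlib

open scoped ENNReal NNReal

/-- The ellipsoid `E_b ⊂ ℝ^d` with semi-axes `b 0, …, b (d - 1)`, in Euclidean space. -/
def ellipsoid {d : ℕ} (b : Fin d → ℝ) : Set (EuclideanSpace ℝ (Fin d)) :=
  {x | ∑ i, x i ^ 2 / b i ^ 2 ≤ 1}

/-- The `ε`-entropy of a set `S ⊆ ℝ^d`: the natural logarithm of the least number of closed
Euclidean balls of radius `ε`, with centres anywhere in `ℝ^d`, that cover `S`.
It is `EReal`-valued, and equal to `⊤` exactly when no finite covering exists. -/
noncomputable def metricEntropy {d : ℕ} (ε : ℝ≥0) (S : Set (EuclideanSpace ℝ (Fin d))) : EReal :=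
  ENNReal.log ((Metric.externalCoveringNumber ε S : ℕ∞) : ℝ≥0∞)

/-- `m_b`, the number of semi-axes that are larger than `1`. -/
noncomputable def numLargeAxes {d : ℕ} (b : Fin d → ℝ) : ℕ :=
  (Finset.univ.filter fun i => 1 < b i).card

/-- `K_b`, the sum of `ln b_i` over the semi-axes `b_i` that are larger than `1`. -/
noncomputable def logVolumeLargeAxes {d : ℕ} (b : Fin d → ℝ) : ℝ :=
  ∑ i ∈ Finset.univ.filter fun i => 1 < b i, Real.log (b i)

open MeasureTheory Metric Module Function

/-! ### Volume tools: packing, nets and a flattening map. -/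

section Volume

variable {E : Type*} [NormedAddCommGroup E] [InnerProductSpace ℝ E] [FiniteDimensional ℝ E]

/-! Fix `δ > 0` and round each `ln b_i` up to a multiple of `δ`, with axes at most `1` sent to level
`0`. This costs at most `δ` per large axis and leaves at most `L/δ + 2` blocks of equal axes, where
`L ≥ 0` bounds every `ln b_i`. Within a block the enlarged ellipsoid is a ball. Once the shares of
the squared norm are discretised, products of ball coverings cover everything
(`exists_cover_ellipsoid_of_blocks`), and each block costs only a factor polynomial in `d`. The
entropy is thus at most `K_b + m_b δ + O((1 + L/δ) ln d)`; if `b_1 > 1`, take `L = ln b_1` and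
balance with `δ = √(L ln d / m_b)`.

The polynomial factor needs an efficient covering of an `r`-ball by unit balls, with `O(n³) rⁿ`
centres (`exists_cover_closedBall`). A centre drawn uniformly from a suitable ball about `0` covers
any given point of the `r`-ball with probability at least `1/(2e n rⁿ)`; greedy choice on a fine net
then loses only polynomial factors. -/

theorem card_le_of_pairwise_dist_lt (s : Finset E) {r η : ℝ} (hr : 0 ≤ r) (hη : 0 < η)
    (hs : ∀ c ∈ s, ‖c‖ ≤ r) (h : (s : Set E).Pairwise fun c e => η < dist c e) :
    (s.card : ℝ) ≤ (1 + 2 * r / η) ^ finrank ℝ E := by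
  borelize E
  let μ : Measure E := Measure.addHaar
  have hη2 : 0 < η / 2 := by positivity
  have D : Set.Pairwise (s : Set E) (Disjoint on fun c => ball (c : E) (η / 2)) := by
    intro c hc e he hce
    apply ball_disjoint_ball
    have := h hc he hce
    linarith
  have hball : ∀ (x : E) {t : ℝ}, 0 < t →
      μ.real (ball x t) = t ^ finrank ℝ E * μ.real (ball 0 1) := fun x t ht => by
    rw [measureReal_def, μ.addHaar_ball_of_pos _ ht, ENNReal.toReal_mul,
      ENNReal.toReal_ofReal (by positivity), measureReal_def]
  have hsub : ⋃ c ∈ s, ball (c : E) (η / 2) ⊆ ball (0 : E) (r + η / 2) := by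
    refine Set.iUnion₂_subset fun x hx => ball_subset_ball' ?_
    rw [dist_zero_right]
    linarith [hs x hx]
  have hR : 0 < r + η / 2 := by positivity
  have h1 : (s.card : ℝ) * (η / 2) ^ finrank ℝ E * μ.real (ball 0 1) ≤
      (r + η / 2) ^ finrank ℝ E * μ.real (ball 0 1) := by
    have h2 : μ.real (⋃ c ∈ s, ball (c : E) (η / 2)) = ∑ c ∈ s, μ.real (ball (c : E) (η / 2)) :=
      measureReal_biUnion_finset D (fun c _ => measurableSet_ball)
        (fun _ _ => measure_ball_lt_top.ne)
    have h3 := measureReal_mono hsub (μ := μ) measure_ball_lt_top.ne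
    rw [h2] at h3
    simp only [hball _ hη2, hball _ hR, Finset.sum_const, nsmul_eq_mul] at h3
    linarith
  have hpos : 0 < μ.real (ball (0 : E) 1) :=
    ENNReal.toReal_pos (measure_ball_pos _ _ zero_lt_one).ne' measure_ball_lt_top.ne
  have h4 := le_of_mul_le_mul_right h1 hpos
  have h5 : 1 + 2 * r / η = (r + η / 2) / (η / 2) := by field_simp; ring
  rw [h5, div_pow, le_div_iff₀ (by positivity)]
  exact h4

theorem exists_finset_net_closedBall {r η : ℝ} (hr : 0 ≤ r) (hη : 0 < η) :
    ∃ s : Finset E, (∀ y ∈ s, ‖y‖ ≤ r) ∧ (∀ x : E, ‖x‖ ≤ r → ∃ y ∈ s, dist x y ≤ η) ∧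
      (s.card : ℝ) ≤ (1 + 2 * r / η) ^ finrank ℝ E := by
  classical
  let P : ℕ → Prop := fun k => ∃ s : Finset E, s.card = k ∧ (∀ y ∈ s, ‖y‖ ≤ r) ∧
    (s : Set E).Pairwise fun c e => η < dist c e
  have hP0 : P 0 := ⟨∅, by simp⟩
  obtain ⟨M, hM⟩ := exists_nat_ge ((1 + 2 * r / η) ^ finrank ℝ E)
  have hb : ∀ k, P k → k ≤ M := by
    rintro k ⟨s, rfl, h1, h2⟩
    exact_mod_cast (card_le_of_pairwise_dist_lt s hr hη h1 h2).trans hM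
  -- A separated set of maximal cardinality is a net: an uncovered point could be added to it.
  obtain ⟨s, hs, h1, h2⟩ : P (Nat.findGreatest P M) := Nat.findGreatest_spec (Nat.zero_le M) hP0
  refine ⟨s, h1, fun x hx => ?_, card_le_of_pairwise_dist_lt s hr hη h1 h2⟩
  by_contra! hcon
  have hxs : x ∉ s := fun h => by
    have := hcon x h
    rw [dist_self] at this
    linarith
  have hP : P (s.card + 1) := by
    refine ⟨insert x s, Finset.card_insert_of_notMem hxs, ?_, ?_⟩
    · intro y hy
      rcases Finset.mem_insert.1 hy with rfl | hy
      exacts [hx, h1 y hy]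
    · rw [Finset.coe_insert]
      refine h2.insert fun y hy _ => ⟨hcon y hy, ?_⟩
      rw [dist_comm]
      exact hcon y hy
  have := Nat.le_findGreatest (hb _ hP) hP
  omega

/-- Shrink the direction of `x` by the factor `1/n` and fix its orthogonal complement. This flattens
a ball into a thin slab while losing only a factor `n` of volume. -/
theorem exists_norm_sub_inner_smul_contraction (x : E) (hn : 0 < finrank ℝ E) :
    ∃ T : E →ₗ[ℝ] E, (1 : ℝ) / finrank ℝ E ≤ LinearMap.det T ∧ (∀ w, ‖T w‖ ≤ ‖w‖) ∧
      ∀ w, |inner ℝ x (T w)| ≤ ‖x‖ * ‖w‖ / finrank ℝ E := by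
  set n : ℝ := (finrank ℝ E : ℝ) with hn'
  have hn1 : 1 ≤ n := by rw [hn']; exact_mod_cast hn
  have hinv : 1 / n ≤ 1 := by rw [div_le_one (by positivity)]; exact hn1
  rcases eq_or_ne x 0 with rfl | hx
  · refine ⟨LinearMap.id, by simpa using hinv, by simp, by simp⟩
  have hx2 : 0 < ‖x‖ ^ 2 := by positivity
  set c : ℝ := (1 - 1 / n) / ‖x‖ ^ 2 with hc
  have hc0 : 0 ≤ c := div_nonneg (by linarith) hx2.le
  have hcx : c * ‖x‖ ^ 2 = 1 - 1 / n := by rw [hc]; field_simp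
  have hn0 : 0 ≤ 1 / n := by positivity
  refine ⟨LinearMap.transvection (innerₛₗ ℝ x) (-(c • x)), ?_, fun w => ?_, fun w => ?_⟩
  · rw [LinearMap.transvection.det]
    simp only [innerₛₗ_apply_apply, inner_neg_right, inner_smul_right, real_inner_self_eq_norm_sq]
    linarith
  · rw [← sq_le_sq₀ (norm_nonneg _) (norm_nonneg _)]
    simp only [LinearMap.transvection.apply, innerₛₗ_apply_apply]
    rw [norm_add_sq_real]
    simp only [inner_smul_right, inner_neg_right, norm_smul, norm_neg, mul_pow, Real.norm_eq_abs,
      sq_abs, real_inner_comm x w]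
    have h1 : c ^ 2 * ‖x‖ ^ 2 ≤ c := by
      have : c ^ 2 * ‖x‖ ^ 2 = c * (1 - 1 / n) := by rw [← hcx]; ring
      rw [this]
      nlinarith
    rw [real_inner_comm]
    nlinarith [sq_nonneg (inner ℝ x w), mul_nonneg hc0 (sq_nonneg (inner ℝ x w)),
      mul_le_mul_of_nonneg_left h1 (sq_nonneg (inner ℝ x w))]
  · simp only [LinearMap.transvection.apply, innerₛₗ_apply_apply, inner_add_right,
      inner_smul_right, inner_neg_right, real_inner_self_eq_norm_sq, hcx]
    have : inner ℝ x w + inner ℝ x w * -(1 - 1 / n) = inner ℝ x w / n := by ring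
    rw [this, abs_div, abs_of_nonneg (by linarith : 0 ≤ n)]
    gcongr
    exact abs_real_inner_le_norm x w

end Volume

/-! ### Probability that a random unit ball covers a given point. -/

section Cap

variable {E : Type*} [NormedAddCommGroup E] [InnerProductSpace ℝ E] [FiniteDimensional ℝ E]
  [MeasurableSpace E] [BorelSpace E]

/-- The flattened ball lies in the union of the half slab and its reflection, which have equal
volume. -/
theorem measureReal_half_slab_ge (μ : Measure E) [μ.IsAddHaarMeasure] (x : E) {q : ℝ}
    (hq : 0 ≤ q) (hn : 0 < finrank ℝ E) :
    q ^ finrank ℝ E / (2 * finrank ℝ E) * μ.real (closedBall 0 1) ≤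
      μ.real {v : E | ‖v‖ ≤ q ∧ 0 ≤ inner ℝ x v ∧ inner ℝ x v ≤ ‖x‖ * q / finrank ℝ E} := by
  obtain ⟨T, hdet, hT, hTx⟩ := exists_norm_sub_inner_smul_contraction x hn
  set S := {v : E | ‖v‖ ≤ q ∧ 0 ≤ inner ℝ x v ∧ inner ℝ x v ≤ ‖x‖ * q / finrank ℝ E} with hS
  have hn0 : (0 : ℝ) < finrank ℝ E := by exact_mod_cast hn
  have hSsub : S ⊆ closedBall 0 q := fun v hv => by simpa using hv.1
  have hfin : μ S ≠ ∞ := ((measure_mono hSsub).trans_lt measure_closedBall_lt_top).ne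
  have hsub : T '' closedBall 0 q ⊆ S ∪ -S := by
    rintro _ ⟨w, hw, rfl⟩
    rw [mem_closedBall_zero_iff] at hw
    have h1 : |inner ℝ x (T w)| ≤ ‖x‖ * q / finrank ℝ E := (hTx w).trans (by gcongr)
    rcases le_total 0 (inner ℝ x (T w)) with h | h
    · exact Or.inl ⟨(hT w).trans hw, h, (le_abs_self _).trans h1⟩
    · refine Or.inr ⟨by simpa using (hT w).trans hw, ?_, ?_⟩
      · rw [inner_neg_right]; linarith
      · rw [inner_neg_right]; exact (neg_le_abs _).trans h1
  have hneg : μ.real (-S) = μ.real S := by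
    rw [measureReal_def, Measure.measure_neg, measureReal_def]
  have hfin' : μ (-S) ≠ ∞ := by rwa [Measure.measure_neg]
  have h2 : μ.real (T '' closedBall 0 q) ≤ 2 * μ.real S := by
    calc _ ≤ μ.real (S ∪ -S) :=
          measureReal_mono hsub (measure_union_lt_top hfin.lt_top hfin'.lt_top).ne
      _ ≤ μ.real S + μ.real (-S) := measureReal_union_le _ _
      _ = _ := by rw [hneg]; ring
  have h3 : μ.real (T '' closedBall 0 q) =
      LinearMap.det T * (q ^ finrank ℝ E * μ.real (closedBall 0 1)) := by
    have : 0 ≤ LinearMap.det T := le_trans (by positivity) hdet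
    rw [← Measure.addHaar_real_closedBall' μ 0 hq, measureReal_def,
      Measure.addHaar_image_linearMap, ENNReal.toReal_mul, abs_of_nonneg this,
      ENNReal.toReal_ofReal this, measureReal_def]
  have h4 : 1 / (finrank ℝ E : ℝ) * (q ^ finrank ℝ E * μ.real (closedBall (0 : E) 1)) ≤
      2 * μ.real S := (mul_le_mul_of_nonneg_right hdet (by positivity)).trans (h3 ▸ h2)
  calc _ = 1 / (finrank ℝ E : ℝ) * (q ^ finrank ℝ E * μ.real (closedBall (0 : E) 1)) / 2 := by
        field_simp
    _ ≤ _ := by linarith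

theorem one_add_one_div_pow_le_exp_one (n : ℕ) : (1 + 1 / (n : ℝ)) ^ n ≤ Real.exp 1 := by
  rcases Nat.eq_zero_or_pos n with rfl | hn
  · simp
  have h : 1 + 1 / (n : ℝ) ≤ Real.exp (1 / n) := by linarith [Real.add_one_le_exp (1 / (n : ℝ))]
  calc _ ≤ Real.exp (1 / n) ^ n := by gcongr
    _ = Real.exp 1 := by
      rw [← Real.exp_nat_mul]
      congr 1
      field_simp

/-- For `‖x‖ = r` the spheres of radius `1` about `x` and `ρ = √(r² - 1)` about `0` meet in a sphere
with centre `q²x` and radius `q = ρ/r`. A half slab at `q²x` pointing along `x` stays in the unit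
ball, and its thinness keeps it within `ρ(1 + 1/n)` of `0`; the extra factor costs at most `e` in
volume. The radius does not depend on `x`, so one distribution of centres serves all points. -/
theorem exists_radius_measureReal_inter_ge (μ : Measure E) [μ.IsAddHaarMeasure] {r : ℝ}
    (hr : 1 < r) (hn : 0 < finrank ℝ E) :
    ∃ R : ℝ, 0 < R ∧ ∀ x : E, ‖x‖ ≤ r →
      1 / (2 * Real.exp 1 * finrank ℝ E * r ^ finrank ℝ E) * μ.real (closedBall (0 : E) R) ≤
        μ.real (closedBall x 1 ∩ closedBall 0 R) := by
  set n := finrank ℝ E with hn_def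
  have hn0 : (0 : ℝ) < n := by exact_mod_cast hn
  set ρ := Real.sqrt (r ^ 2 - 1) with hρ
  have hρ2 : ρ ^ 2 = r ^ 2 - 1 := Real.sq_sqrt (by nlinarith)
  have hρ0 : 0 < ρ := Real.sqrt_pos.2 (by nlinarith)
  have hr0 : 0 < r := by linarith
  have hρr : ρ ≤ r := by nlinarith
  set q := ρ / r with hq
  have hq0 : 0 < q := by positivity
  have hqr : q * r = ρ := by rw [hq]; field_simp
  have hq2 : q ^ 2 = 1 - 1 / r ^ 2 := by rw [hq, div_pow, hρ2]; field_simp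
  refine ⟨ρ * (1 + 1 / n), by positivity, fun x hx => ?_⟩
  set S := {v : E | ‖v‖ ≤ q ∧ 0 ≤ inner ℝ x v ∧ inner ℝ x v ≤ ‖x‖ * q / n} with hS
  have hslab := measureReal_half_slab_ge μ x hq0.le hn
  have hsub : (fun v => q ^ 2 • x + v) '' S ⊆ closedBall x 1 ∩ closedBall 0 (ρ * (1 + 1 / n)) := by
    rintro _ ⟨v, ⟨hv, hv0, hv1⟩, rfl⟩
    have hv2 : ‖v‖ ^ 2 ≤ q ^ 2 := by gcongr
    have hx2 : ‖x‖ ^ 2 ≤ r ^ 2 := by gcongr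
    constructor
    · rw [mem_closedBall, dist_comm, dist_eq_norm]
      rw [← sq_le_sq₀ (norm_nonneg _) zero_le_one]
      have h1 : x - (q ^ 2 • x + v) = (1 / r ^ 2 : ℝ) • x - v := by
        rw [hq2]; module
      rw [h1, norm_sub_sq_real, norm_smul, mul_pow, Real.norm_eq_abs, sq_abs, inner_smul_left]
      have h2 : (1 / r ^ 2) ^ 2 * ‖x‖ ^ 2 ≤ 1 / r ^ 2 := by
        calc _ ≤ (1 / r ^ 2) ^ 2 * r ^ 2 := by gcongr
          _ = _ := by field_simp
      have h3 : 0 ≤ (1 / r ^ 2) * inner ℝ x v := by positivity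
      simp only [conj_trivial]
      linarith
    · rw [mem_closedBall_zero_iff, ← sq_le_sq₀ (norm_nonneg _) (by positivity)]
      rw [norm_add_sq_real, norm_smul, mul_pow, Real.norm_eq_abs, sq_abs, inner_smul_left]
      simp only [conj_trivial]
      have h2 : inner ℝ x v ≤ ρ / n := by
        refine hv1.trans ?_
        rw [← hqr, mul_comm q]
        gcongr
      have h3 : (q ^ 2) ^ 2 * ‖x‖ ^ 2 ≤ q ^ 2 * ρ ^ 2 := by
        calc _ ≤ (q ^ 2) ^ 2 * r ^ 2 := by gcongr
          _ = _ := by rw [← hqr]; ring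
      have h4 : q ^ 2 * inner ℝ x v ≤ ρ ^ 2 / n := by
        calc q ^ 2 * inner ℝ x v ≤ q ^ 2 * (ρ / n) := by gcongr
          _ ≤ ρ * (ρ / n) := by
            gcongr
            have : q ≤ 1 := by rw [hq, div_le_one hr0]; exact hρr
            have : q ≤ ρ := by rw [← hqr]; nlinarith
            nlinarith
          _ = _ := by ring
      have h5 : q ^ 2 * ρ ^ 2 + q ^ 2 = ρ ^ 2 := by
        rw [← hqr]
        have : q ^ 2 * r ^ 2 = r ^ 2 - 1 := by rw [← mul_pow, hqr, hρ2]
        linear_combination q ^ 2 * this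
      have h6 : (ρ * (1 + 1 / n)) ^ 2 = ρ ^ 2 + 2 * (ρ ^ 2 / n) + (ρ / n) ^ 2 := by
        field_simp; ring
      nlinarith [sq_nonneg (ρ / n)]
  have h1 : μ.real S ≤ μ.real (closedBall x 1 ∩ closedBall 0 (ρ * (1 + 1 / n))) := by
    calc μ.real S = μ.real ((fun v => q ^ 2 • x + v) '' S) := by
          simp only [measureReal_def, Set.image_add_left, measure_preimage_add]
      _ ≤ _ := measureReal_mono hsub
        ((measure_mono Set.inter_subset_left).trans_lt measure_closedBall_lt_top).ne
  refine le_trans ?_ (hslab.trans h1)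
  rw [Measure.addHaar_real_closedBall' μ 0 (by positivity : 0 ≤ ρ * (1 + 1 / n)), ← mul_assoc,
    ← hn_def]
  gcongr
  rw [mul_pow, hq, div_pow]
  calc _ ≤ 1 / (2 * Real.exp 1 * n * r ^ n) * (ρ ^ n * Real.exp 1) := by
        gcongr
        exact one_add_one_div_pow_le_exp_one n
    _ = _ := by field_simp

/-- Average the number of covered points over centres uniform in the ball of radius `R`: some centre
does at least as well as the mean. -/
theorem exists_center_covering_proportion (hn : 0 < finrank ℝ E) {r : ℝ} (hr : 1 < r)
    (Y : Finset E) (hY : ∀ y ∈ Y, ‖y‖ ≤ r) :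
    ∃ c : E, 1 / (2 * Real.exp 1 * finrank ℝ E * r ^ finrank ℝ E) * (Y.card : ℝ) ≤
      ((Y.filter fun y => dist c y ≤ 1).card : ℝ) := by
  let μ : Measure E := Measure.addHaar
  obtain ⟨R, hR, h⟩ := exists_radius_measureReal_inter_ge μ hr hn
  set p := 1 / (2 * Real.exp 1 * finrank ℝ E * r ^ finrank ℝ E) with hp
  have hμ0 : μ (closedBall (0 : E) R) ≠ 0 := (measure_closedBall_pos μ _ hR).ne'
  have hμ1 : μ (closedBall (0 : E) R) ≠ ∞ := measure_closedBall_lt_top.ne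
  let f : E → ℝ := fun c => ∑ y ∈ Y, (closedBall y 1).indicator (fun _ => (1 : ℝ)) c
  have hint : ∀ y ∈ Y, IntegrableOn ((closedBall y 1).indicator fun _ => (1 : ℝ))
      (closedBall 0 R) μ := fun y _ =>
    (integrableOn_const (μ := μ) (s := closedBall (0 : E) R) (C := (1 : ℝ)) hμ1).indicator
      measurableSet_closedBall
  obtain ⟨c, -, hc⟩ := exists_setAverage_le hμ0 hμ1 (integrable_finsetSum Y hint : IntegrableOn f _ μ)
  refine ⟨c, ?_⟩
  have hfc : f c = ((Y.filter fun y => dist c y ≤ 1).card : ℝ) := by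
    rw [Finset.card_filter, Nat.cast_sum]
    refine Finset.sum_congr rfl fun y _ => ?_
    by_cases hy : dist c y ≤ 1
    · rw [Set.indicator_of_mem (mem_closedBall.2 hy), if_pos hy, Nat.cast_one]
    · rw [Set.indicator_of_notMem (fun h => hy (mem_closedBall.1 h)), if_neg hy, Nat.cast_zero]
  rw [← hfc]
  refine le_trans ?_ hc
  rw [setAverage_eq, smul_eq_mul]
  have hpos : 0 < μ.real (closedBall (0 : E) R) := ENNReal.toReal_pos hμ0 hμ1
  rw [le_inv_mul_iff₀ hpos, integral_finsetSum Y hint]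
  calc μ.real (closedBall 0 R) * (p * Y.card)
      = ∑ y ∈ Y, p * μ.real (closedBall 0 R) := by simp; ring
    _ ≤ _ := Finset.sum_le_sum fun y hy => by
      rw [integral_indicator_const _ measurableSet_closedBall, smul_eq_mul, mul_one,
        measureReal_restrict_apply measurableSet_closedBall]
      exact h y (hY y hy)

end Cap

/-! ### Greedy covering of a finite set. -/

theorem exists_greedy_cover {α β : Type*} [DecidableEq β] (X : Finset α) (R : β → α → Prop)
    [∀ c a, Decidable (R c a)] {p : ℝ} (hp : p ≤ 1)
    (h : ∀ Y ⊆ X, ∃ c, p * (Y.card : ℝ) ≤ ((Y.filter fun y => R c y).card : ℝ)) (k : ℕ) :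
    ∃ C : Finset β, C.card ≤ k ∧
      ((X.filter fun y => ∀ c ∈ C, ¬ R c y).card : ℝ) ≤ (1 - p) ^ k * X.card := by
  induction k with
  | zero => exact ⟨∅, by simp⟩
  | succ k ih =>
    obtain ⟨C, hC, hcard⟩ := ih
    obtain ⟨c, hc⟩ := h _ (X.filter_subset fun y => ∀ c ∈ C, ¬ R c y)
    refine ⟨insert c C, (Finset.card_insert_le _ _).trans (by omega), ?_⟩
    set Y := X.filter fun y => ∀ c ∈ C, ¬ R c y
    have h1 : (X.filter fun y => ∀ e ∈ insert c C, ¬ R e y) = Y.filter fun y => ¬ R c y := by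
      ext y
      simp only [Y, Finset.mem_filter, Finset.forall_mem_insert]
      tauto
    have h2 := Finset.card_filter_add_card_filter_not (s := Y) (fun y => R c y)
    have h3 : ((Y.filter fun y => R c y).card : ℝ) + (Y.filter fun y => ¬ R c y).card = Y.card := by
      exact_mod_cast h2
    rw [h1, pow_succ]
    nlinarith [mul_le_mul_of_nonneg_left hcard (sub_nonneg.2 hp)]

/-! ### Covering a ball by smaller balls. -/

section BallCovering

variable {E : Type*} [NormedAddCommGroup E] [InnerProductSpace ℝ E] [FiniteDimensional ℝ E]

theorem exists_cover_closedBall_one_add (hn : 0 < finrank ℝ E) {r : ℝ} (hr : 1 < r) :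
    ∃ C : Finset E, (C.card : ℝ) ≤ 20 * (finrank ℝ E : ℝ) ^ 3 * r ^ finrank ℝ E ∧
      ∀ x : E, ‖x‖ ≤ r → ∃ c ∈ C, dist x c ≤ 1 + 1 / finrank ℝ E := by
  classical
  borelize E
  set n := finrank ℝ E with hn_def
  have hn1 : (1 : ℝ) ≤ n := by exact_mod_cast hn
  have hr0 : 0 < r := by linarith
  have hrn : 1 ≤ r ^ n := one_le_pow₀ hr.le
  obtain ⟨X, hXr, hXnet, hXcard⟩ := exists_finset_net_closedBall (E := E) hr0.le
    (by positivity : 0 < 1 / (n : ℝ))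
  set p := 1 / (2 * Real.exp 1 * n * r ^ n) with hp
  have hp0 : 0 < p := by positivity
  have hp1 : p ≤ 1 := by
    rw [hp, div_le_one (by positivity)]
    have h1 : 1 ≤ 2 * Real.exp 1 := by linarith [Real.one_le_exp zero_le_one]
    have h2 : 1 ≤ 2 * Real.exp 1 * n := one_le_mul_of_one_le_of_one_le h1 hn1
    exact one_le_mul_of_one_le_of_one_le h2 hrn
  have hXcard' : (X.card : ℝ) ≤ (3 * n) ^ n * r ^ n := by
    refine hXcard.trans ?_
    rw [← hn_def, ← mul_pow]
    gcongr
    rw [div_div_eq_mul_div, div_one]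
    nlinarith
  -- `A / p` greedy steps shrink the net by the factor `(3n)ⁿ`, leaving at most `rⁿ` points, which
  -- become centres themselves.
  set A := Real.log ((3 * n : ℝ) ^ n) with hA
  have hA1 : A ≤ 3 * n ^ 2 := by
    rw [hA, Real.log_pow]
    have := Real.log_le_sub_one_of_pos (by positivity : 0 < 3 * (n : ℝ))
    nlinarith
  have hA0 : 0 ≤ A := Real.log_nonneg (one_le_pow₀ (by linarith))
  obtain ⟨C, hCk, hC⟩ := exists_greedy_cover X (fun c y => dist c y ≤ 1) hp1
    (fun Y hY => exists_center_covering_proportion hn hr Y fun y hy => hXr y (hY hy)) ⌈A / p⌉₊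
  set Z := X.filter fun y => ∀ c ∈ C, ¬ dist c y ≤ 1 with hZ
  have hZcard : (Z.card : ℝ) ≤ r ^ n := by
    refine hC.trans ?_
    have h1 : (1 - p) ^ ⌈A / p⌉₊ ≤ ((3 * n : ℝ) ^ n)⁻¹ := by
      calc (1 - p) ^ ⌈A / p⌉₊ ≤ Real.exp (-p) ^ ⌈A / p⌉₊ := by
            gcongr
            exact Real.one_sub_le_exp_neg p
        _ = Real.exp (-(⌈A / p⌉₊ * p)) := by rw [← Real.exp_nat_mul]; ring_nf
        _ ≤ Real.exp (-A) := by
          rw [Real.exp_le_exp, neg_le_neg_iff, ← div_le_iff₀ hp0]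
          exact Nat.le_ceil _
        _ = _ := by rw [Real.exp_neg, hA, Real.exp_log (by positivity)]
    calc _ ≤ ((3 * n : ℝ) ^ n)⁻¹ * ((3 * n) ^ n * r ^ n) := by gcongr
      _ = r ^ n := by field_simp
  refine ⟨C ∪ Z, ?_, fun x hx => ?_⟩
  · have h1 : ((C ∪ Z).card : ℝ) ≤ C.card + Z.card := by exact_mod_cast Finset.card_union_le C Z
    have h2 : (C.card : ℝ) ≤ A / p + 1 :=
      (Nat.cast_le.2 hCk).trans (Nat.ceil_lt_add_one (by positivity)).le
    have h3 : A / p ≤ 6 * Real.exp 1 * (n ^ 3 * r ^ n) := by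
      rw [hp, div_div_eq_mul_div, div_one]
      calc _ ≤ 3 * (n : ℝ) ^ 2 * (2 * Real.exp 1 * n * r ^ n) := by gcongr
        _ = _ := by ring
    have h4 : r ^ n ≤ n ^ 3 * r ^ n := le_mul_of_one_le_left (by positivity) (one_le_pow₀ hn1)
    have h5 : 6 * Real.exp 1 * (n ^ 3 * r ^ n) ≤ 18 * (n ^ 3 * r ^ n) := by
      gcongr
      linarith [Real.exp_one_lt_d9]
    nlinarith
  · obtain ⟨y, hy, hxy⟩ := hXnet x hx
    by_cases hyZ : y ∈ Z
    · exact ⟨y, Finset.mem_union_right _ hyZ, by linarith⟩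
    · rw [hZ, Finset.mem_filter] at hyZ
      push Not at hyZ
      obtain ⟨c, hc, hcy⟩ := hyZ hy
      refine ⟨c, Finset.mem_union_left _ hc, (dist_triangle x y c).trans ?_⟩
      rw [dist_comm y c]
      linarith

theorem exists_cover_closedBall (hn : 0 < finrank ℝ E) {r R : ℝ} (hr : 1 < r) (hR : 0 < R) :
    ∃ C : Finset E, (C.card : ℝ) ≤ 60 * (finrank ℝ E : ℝ) ^ 3 * r ^ finrank ℝ E ∧
      ∀ x : E, ‖x‖ ≤ r * R → ∃ c ∈ C, dist x c ≤ R := by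
  classical
  set n := finrank ℝ E with hn_def
  have hn1 : (1 : ℝ) ≤ n := by exact_mod_cast hn
  have hn0 : 0 < 1 / (n : ℝ) := by positivity
  set a := 1 + 1 / (n : ℝ) with ha
  have ha0 : 0 < a := by positivity
  -- Rescaling absorbs the net error `1/n`: replacing `r` by `r * a` costs only `aⁿ ≤ 3`.
  obtain ⟨C, hC, hcov⟩ := exists_cover_closedBall_one_add hn
    (by nlinarith : 1 < r * a)
  refine ⟨C.image fun c => (R / a) • c, ?_, fun x hx => ?_⟩
  · have h1 : ((C.image fun c => (R / a) • c).card : ℝ) ≤ C.card := by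
      exact_mod_cast Finset.card_image_le
    refine h1.trans (hC.trans ?_)
    rw [← hn_def, mul_pow]
    have h2 : a ^ n ≤ 3 := (one_add_one_div_pow_le_exp_one n).trans
      (Real.exp_one_lt_d9.le.trans (by norm_num))
    calc _ ≤ 20 * (n : ℝ) ^ 3 * (r ^ n * 3) := by gcongr
      _ = _ := by ring
  · obtain ⟨c, hc, hxc⟩ := hcov ((a / R) • x) (by
      rw [norm_smul, Real.norm_of_nonneg (by positivity)]
      calc a / R * ‖x‖ ≤ a / R * (r * R) := by gcongr
        _ = r * a := by field_simp)
    refine ⟨_, Finset.mem_image_of_mem _ hc, ?_⟩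
    have h1 : x - (R / a) • c = (R / a) • ((a / R) • x - c) := by
      rw [smul_sub, smul_smul]
      field_simp
      simp
    rw [dist_eq_norm, h1, norm_smul, Real.norm_of_nonneg (by positivity), ← dist_eq_norm]
    calc R / a * dist ((a / R) • x) c ≤ R / a * a := by gcongr
      _ = R := by field_simp

end BallCovering

/-! ### Ellipsoids by blocks of coordinates. -/

theorem prod_pow_card_fiber {α ι M : Type*} [Fintype α] [Fintype ι] [DecidableEq ι] [CommMonoid M]
    (f : α → ι) (r : ι → M) : ∏ j, r j ^ Fintype.card {i // f i = j} = ∏ i, r (f i) := by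
  rw [← Fintype.prod_fiberwise' f r]
  simp

/-- Blockwise balls `‖y j‖ ^ 2 ≤ β j ^ 2 * s` are covered by balls of squared radius
comparable to `s`; glueing the block centres gives centres in the whole space. -/
theorem exists_cover_ellipsoid_of_blocks {d : ℕ} (hd : 2 ≤ d) {ι : Type*} [Fintype ι]
    [DecidableEq ι] (f : Fin d → ι) (hf : Surjective f) (b : Fin d → ℝ) (hb : ∀ i, 0 < b i)
    (β : ι → ℝ) (hβ : ∀ j, 1 ≤ β j) (hbβ : ∀ i, b i ≤ β (f i)) :
    ∃ C : Finset (EuclideanSpace ℝ (Fin d)), (∀ x ∈ ellipsoid b, ∃ c ∈ C, dist x c ≤ 1) ∧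
      (C.card : ℝ) ≤ 3 * ((d : ℝ) ^ 12) ^ Fintype.card ι * ∏ i, β (f i) := by
  classical
  set T := Fintype.card ι with hT
  have hTd : T ≤ d := by simpa using Fintype.card_le_of_surjective f hf
  have hT0 : 0 < T := Fintype.card_pos_iff.2 ⟨f ⟨0, by omega⟩⟩
  have hd2 : (2 : ℝ) ≤ d := by exact_mod_cast hd
  have hd0 : (0 : ℝ) < d := by linarith
  set D := T * d with hD
  have hD0 : (0 : ℝ) < D := by rw [hD]; push_cast; positivity
  -- Rounding the shares up to multiples of `1/D` adds at most `T/D = 1/d` in total, and dividing by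
  -- `κ` restores the sum to `1`. Also `√κ > 1` keeps the radius ratio above `1` when `β j = 1`.
  set κ : ℝ := 1 + 1 / d with hκ
  have hκ1 : 1 < κ := by rw [hκ]; linarith [show 0 < 1 / (d : ℝ) by positivity]
  have hκ0 : 0 < κ := by linarith
  have hsκ : 1 < √κ := by rwa [Real.lt_sqrt zero_le_one, one_pow]
  have hβ0 : ∀ j, 0 < β j := fun j => by linarith [hβ j]
  let R : ℕ → ℝ := fun k => √((k + 1) / (D * κ))
  have hR : ∀ k, 0 < R k := fun k => Real.sqrt_pos.2 (by positivity)
  have hR2 : ∀ k : ℕ, R k ^ 2 = (k + 1) / (D * κ) := fun k => Real.sq_sqrt (by positivity)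
  have hfin : ∀ j, finrank ℝ (EuclideanSpace ℝ {i // f i = j}) = Fintype.card {i // f i = j} :=
    fun j => finrank_euclideanSpace
  have hcov : ∀ j (k : ℕ), ∃ C : Finset (EuclideanSpace ℝ {i // f i = j}),
      (C.card : ℝ) ≤ (d : ℝ) ^ 9 * (β j * √κ) ^ Fintype.card {i // f i = j} ∧
      ∀ y, ‖y‖ ≤ β j * √κ * R k → ∃ c ∈ C, dist y c ≤ R k := by
    intro j k
    have hpos : 0 < finrank ℝ (EuclideanSpace ℝ {i // f i = j}) := by
      obtain ⟨i, hi⟩ := hf j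
      rw [hfin, Fintype.card_pos_iff]
      exact ⟨⟨i, hi⟩⟩
    obtain ⟨C, hC, h⟩ := exists_cover_closedBall hpos
      (one_lt_mul_of_le_of_lt (hβ j) hsκ) (hR k)
    refine ⟨C, hC.trans ?_, h⟩
    rw [hfin]
    have h1 : (Fintype.card {i // f i = j} : ℝ) ≤ d := by
      have := Fintype.card_subtype_le fun i => f i = j
      rw [Fintype.card_fin] at this
      exact_mod_cast this
    have h2 : (60 : ℝ) ≤ d ^ 6 := by
      calc (60 : ℝ) ≤ 2 ^ 6 := by norm_num
        _ ≤ d ^ 6 := by gcongr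
    have := hβ0 j
    calc _ ≤ (d : ℝ) ^ 6 * d ^ 3 * (β j * √κ) ^ Fintype.card {i // f i = j} := by gcongr
      _ = _ := by ring
  choose C hCcard hC using hcov
  let glue : (∀ j, EuclideanSpace ℝ {i // f i = j}) → EuclideanSpace ℝ (Fin d) :=
    fun c => WithLp.toLp 2 fun i => c (f i) ⟨i, rfl⟩
  refine ⟨Finset.univ.biUnion fun k : ι → Fin (D + 1) =>
    (Fintype.piFinset fun j => C j (k j)).image glue, fun x hx => ?_, ?_⟩
  · let y : ∀ j, EuclideanSpace ℝ {i // f i = j} := fun j => WithLp.toLp 2 fun i => x i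
    have hy2 : ∀ j, ‖y j‖ ^ 2 = ∑ i : {i // f i = j}, x i ^ 2 := fun j => by
      rw [EuclideanSpace.real_norm_sq_eq]
    have hsum : ∑ j, ‖y j‖ ^ 2 / β j ^ 2 ≤ 1 := by
      calc ∑ j, ‖y j‖ ^ 2 / β j ^ 2
          = ∑ j, ∑ i : {i // f i = j}, x i ^ 2 / β (f i) ^ 2 := by
            refine Finset.sum_congr rfl fun j _ => ?_
            rw [hy2, Finset.sum_div]
            refine Finset.sum_congr rfl fun i _ => ?_
            rw [i.2]
        _ = ∑ i, x i ^ 2 / β (f i) ^ 2 := Fintype.sum_fiberwise f fun i => x i ^ 2 / β (f i) ^ 2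
        _ ≤ ∑ i, x i ^ 2 / b i ^ 2 := by
            refine Finset.sum_le_sum fun i _ => ?_
            have := hb i
            have := hbβ i
            gcongr
        _ ≤ 1 := hx
    have hσ : ∀ j, ‖y j‖ ^ 2 / β j ^ 2 ≤ 1 := fun j =>
      (Finset.single_le_sum (f := fun j => ‖y j‖ ^ 2 / β j ^ 2)
        (fun j _ => by positivity) (Finset.mem_univ j)).trans hsum
    -- The profile `k` records the rounded shares; there are `(D + 1)^T ≤ d^(3T)` profiles.
    let k : ι → Fin (D + 1) := fun j => ⟨⌊D * (‖y j‖ ^ 2 / β j ^ 2)⌋₊, by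
      rw [Nat.lt_succ_iff]
      refine Nat.floor_le_of_le ?_
      exact mul_le_of_le_one_right hD0.le (hσ j)⟩
    have hky : ∀ j, ‖y j‖ ≤ β j * √κ * R (k j) := fun j => by
      have := hβ0 j
      have := hR (k j)
      rw [← sq_le_sq₀ (norm_nonneg _) (by positivity), mul_pow, mul_pow, hR2, Real.sq_sqrt hκ0.le]
      have h1 : D * (‖y j‖ ^ 2 / β j ^ 2) ≤ (k j : ℕ) + 1 := (Nat.lt_floor_add_one _).le
      have h2 : β j ^ 2 * κ * (((k j : ℕ) + 1) / (D * κ)) = β j ^ 2 * ((k j : ℕ) + 1) / D := by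
        field_simp
      rw [h2, le_div_iff₀ hD0]
      calc ‖y j‖ ^ 2 * D = β j ^ 2 * (D * (‖y j‖ ^ 2 / β j ^ 2)) := by field_simp
        _ ≤ _ := by gcongr
    choose c hcC hc using fun j => hC j (k j) (y j) (hky j)
    refine ⟨glue c, ?_, ?_⟩
    · exact Finset.mem_biUnion.2 ⟨k, Finset.mem_univ _,
        Finset.mem_image_of_mem _ (Fintype.mem_piFinset.2 hcC)⟩
    · rw [← sq_le_sq₀ dist_nonneg zero_le_one, dist_eq_norm, EuclideanSpace.real_norm_sq_eq]
      have h1 : ∑ i, (x - glue c) i ^ 2 = ∑ j, dist (y j) (c j) ^ 2 := by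
        rw [← Fintype.sum_fiberwise f]
        refine Finset.sum_congr rfl fun j _ => ?_
        rw [dist_eq_norm, EuclideanSpace.real_norm_sq_eq]
        refine Finset.sum_congr rfl ?_
        rintro ⟨i, rfl⟩ -
        rfl
      have hTD : (T : ℝ) / D = 1 / d := by
        have : (0 : ℝ) < T := by exact_mod_cast hT0
        rw [hD]; push_cast; field_simp
      rw [h1]
      calc ∑ j, dist (y j) (c j) ^ 2 ≤ ∑ j, (‖y j‖ ^ 2 / β j ^ 2 + 1 / D) / κ := by
            refine Finset.sum_le_sum fun j _ => ?_
            calc dist (y j) (c j) ^ 2 ≤ R (k j) ^ 2 := by gcongr; exact hc j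
              _ = (((k j : ℕ) + 1) / D) / κ := by rw [hR2, div_div]
              _ ≤ _ := by
                have h2 : ((k j : ℕ) : ℝ) ≤ D * (‖y j‖ ^ 2 / β j ^ 2) :=
                  Nat.floor_le (by positivity)
                gcongr
                rw [div_le_iff₀ hD0, add_mul, one_div_mul_cancel hD0.ne']
                linarith
        _ = (∑ j, ‖y j‖ ^ 2 / β j ^ 2 + T / D) / κ := by
            rw [← Finset.sum_div, Finset.sum_add_distrib, Finset.sum_const, Finset.card_univ,
              nsmul_eq_mul, mul_one_div]
        _ ≤ (1 + 1 / d) / κ := by rw [hTD]; gcongr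
        _ = 1 ^ 2 := by rw [← hκ, div_self hκ0.ne', one_pow]
  · have h1 : ∀ k : ι → Fin (D + 1),
        (((Fintype.piFinset fun j => C j (k j)).image glue).card : ℝ) ≤
          (d ^ 9) ^ T * (√κ ^ d * ∏ i, β (f i)) := by
      intro k
      calc (((Fintype.piFinset fun j => C j (k j)).image glue).card : ℝ)
          ≤ ∏ j, ((C j (k j)).card : ℝ) := by
            rw [← Nat.cast_prod, ← Fintype.card_piFinset]
            exact_mod_cast Finset.card_image_le
        _ ≤ ∏ j, ((d : ℝ) ^ 9 * (β j * √κ) ^ Fintype.card {i // f i = j}) :=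
            Finset.prod_le_prod (fun _ _ => by positivity) fun j _ => hCcard j (k j)
        _ = _ := by
            rw [Finset.prod_mul_distrib, prod_pow_card_fiber f fun j => β j * √κ,
              Finset.prod_mul_distrib]
            simp only [Finset.prod_const, Finset.card_univ, Fintype.card_fin]
            ring
    have hβp : 0 ≤ ∏ i, β (f i) := Finset.prod_nonneg fun i _ => (hβ0 _).le
    have hκd : √κ ^ d ≤ 3 := by
      calc √κ ^ d ≤ κ ^ d := by
            gcongr
            rw [Real.sqrt_le_iff]
            exact ⟨hκ0.le, by nlinarith⟩
        _ ≤ 3 := (one_add_one_div_pow_le_exp_one d).trans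
          (Real.exp_one_lt_d9.le.trans (by norm_num))
    have hDd : (D : ℝ) + 1 ≤ d ^ 3 := by
      have : (T : ℝ) ≤ d := by exact_mod_cast hTd
      rw [hD]; push_cast
      calc (T : ℝ) * d + 1 ≤ d * d + 1 := by gcongr
        _ ≤ d ^ 3 := by nlinarith [mul_le_mul_of_nonneg_left hd2 (mul_self_nonneg (d : ℝ))]
    calc _ ≤ ∑ k : ι → Fin (D + 1),
          (((Fintype.piFinset fun j => C j (k j)).image glue).card : ℝ) := by
          exact_mod_cast Finset.card_biUnion_le
      _ ≤ ∑ _k : ι → Fin (D + 1), (d ^ 9) ^ T * (√κ ^ d * ∏ i, β (f i)) :=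
          Finset.sum_le_sum fun k _ => h1 k
      _ = ((D : ℝ) + 1) ^ T * ((d ^ 9) ^ T * (√κ ^ d * ∏ i, β (f i))) := by
          rw [Finset.sum_const, Finset.card_univ, Fintype.card_fun, Fintype.card_fin, nsmul_eq_mul]
          push_cast
          rfl
      _ ≤ (d ^ 3) ^ T * ((d ^ 9) ^ T * (3 * ∏ i, β (f i))) := by gcongr
      _ = _ := by ring

/-! ### Entropy bounds and the choice of `δ`. -/

theorem metricEntropy_le_of_cover {d : ℕ} {S : Set (EuclideanSpace ℝ (Fin d))}
    {C : Finset (EuclideanSpace ℝ (Fin d))} (hC : ∀ x ∈ S, ∃ c ∈ C, dist x c ≤ 1) {B : ℝ}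
    (hB : (C.card : ℝ) ≤ Real.exp B) : metricEntropy 1 S ≤ (B : EReal) := by
  have hcov : IsCover 1 S (C : Set (EuclideanSpace ℝ (Fin d))) := by
    rw [isCover_iff_subset_iUnion_closedBall]
    intro x hx
    obtain ⟨c, hc, hxc⟩ := hC x hx
    exact Set.mem_iUnion₂.2 ⟨c, hc, hxc⟩
  have h1 : externalCoveringNumber 1 S ≤ (C.card : ℕ∞) := by
    simpa using hcov.externalCoveringNumber_le_encard
  have h2 : ((externalCoveringNumber 1 S : ℕ∞) : ℝ≥0∞) ≤ ENNReal.ofReal (Real.exp B) := by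
    calc ((externalCoveringNumber 1 S : ℕ∞) : ℝ≥0∞) ≤ ((C.card : ℕ∞) : ℝ≥0∞) := by
          exact_mod_cast h1
      _ = ENNReal.ofReal (C.card : ℝ) := by simp
      _ ≤ _ := ENNReal.ofReal_le_ofReal hB
  calc metricEntropy 1 S ≤ ENNReal.log (ENNReal.ofReal (Real.exp B)) :=
        ENNReal.log_monotone h2
    _ = _ := by rw [ENNReal.log_ofReal_of_pos (Real.exp_pos B), Real.log_exp]

theorem metricEntropy_ellipsoid_le {d : ℕ} (hd : 2 ≤ d) (b : Fin d → ℝ) (hb : ∀ i, 0 < b i)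
    {L δ : ℝ} (hL : 0 ≤ L) (hbL : ∀ i, Real.log (b i) ≤ L) (hδ : 0 < δ) :
    metricEntropy 1 (ellipsoid b) ≤
      ((logVolumeLargeAxes b + numLargeAxes b * δ + (26 + 12 * (L / δ)) * Real.log d : ℝ) :
        EReal) := by
  classical
  -- The natural-number ceiling truncates at `0`, so axes at most `1` cost nothing.
  let g : Fin d → ℕ := fun i => ⌈Real.log (b i) / δ⌉₊
  let f : Fin d → Finset.univ.image g := fun i => ⟨g i, Finset.mem_image_of_mem g (Finset.mem_univ i)⟩
  have hf : Surjective f := by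
    rintro ⟨k, hk⟩
    obtain ⟨i, -, rfl⟩ := Finset.mem_image.1 hk
    exact ⟨i, rfl⟩
  obtain ⟨C, hC, hcard⟩ := exists_cover_ellipsoid_of_blocks hd f hf b hb
    (fun k => Real.exp (k.1 * δ)) (fun k => Real.one_le_exp (by positivity)) (fun i => by
      rw [← Real.log_le_iff_le_exp (hb i), ← div_le_iff₀ hδ]
      exact Nat.le_ceil _)
  refine metricEntropy_le_of_cover hC (hcard.trans ?_)
  have hd2 : (2 : ℝ) ≤ d := by exact_mod_cast hd
  have hd0 : (0 : ℝ) < d := by linarith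
  have hlog : 0 ≤ Real.log d := Real.log_nonneg (by linarith)
  have hT : (Fintype.card (Finset.univ.image g) : ℝ) ≤ L / δ + 2 := by
    have h1 : Finset.univ.image g ⊆ Finset.range (⌈L / δ⌉₊ + 1) := by
      intro k hk
      obtain ⟨i, -, rfl⟩ := Finset.mem_image.1 hk
      rw [Finset.mem_range, Nat.lt_succ_iff]
      exact Nat.ceil_mono (div_le_div_of_nonneg_right (hbL i) hδ.le)
    have h2 := Finset.card_le_card h1
    rw [Finset.card_range] at h2
    rw [Fintype.card_coe]
    calc ((Finset.univ.image g).card : ℝ) ≤ (⌈L / δ⌉₊ : ℝ) + 1 := by exact_mod_cast h2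
      _ ≤ L / δ + 2 := by linarith [Nat.ceil_lt_add_one (div_nonneg hL hδ.le)]
  have hK : ∑ i, (g i : ℝ) * δ ≤ logVolumeLargeAxes b + numLargeAxes b * δ := by
    have h1 : ∀ i, (g i : ℝ) * δ ≤ if 1 < b i then Real.log (b i) + δ else 0 := by
      intro i
      split_ifs with h
      · have h2 := Nat.ceil_lt_add_one (div_nonneg (Real.log_nonneg h.le) hδ.le)
        calc (g i : ℝ) * δ ≤ (Real.log (b i) / δ + 1) * δ := by gcongr
          _ = _ := by field_simp
      · have h2 : g i = 0 := Nat.ceil_eq_zero.2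
          (div_nonpos_of_nonpos_of_nonneg (Real.log_nonpos (hb i).le (not_lt.1 h)) hδ.le)
        simp [h2]
    refine (Finset.sum_le_sum fun i _ => h1 i).trans_eq ?_
    rw [← Finset.sum_filter, Finset.sum_add_distrib, Finset.sum_const, nsmul_eq_mul]
    rfl
  have h3 : (3 : ℝ) ≤ Real.exp (2 * Real.log d) := by
    rw [two_mul, Real.exp_add, Real.exp_log hd0]
    nlinarith
  have h12 : ((d : ℝ) ^ 12) ^ Fintype.card (Finset.univ.image g) ≤
      Real.exp (12 * (L / δ + 2) * Real.log d) := by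
    rw [← pow_mul, ← Real.exp_log (pow_pos hd0 _), Real.log_pow, Real.exp_le_exp]
    push_cast
    gcongr
  have hprod : ∏ i, Real.exp ((f i).1 * δ) = Real.exp (∑ i, (g i : ℝ) * δ) :=
    (Real.exp_sum _ _).symm
  rw [hprod]
  calc _ ≤ Real.exp (2 * Real.log d) * Real.exp (12 * (L / δ + 2) * Real.log d) *
        Real.exp (logVolumeLargeAxes b + numLargeAxes b * δ) := by gcongr
    _ = _ := by
      rw [← Real.exp_add, ← Real.exp_add]
      ring_nf

theorem theorem4 :
    ∃ c : ℝ, 0 < c ∧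
      ∀ (d : ℕ) (hd : 2 ≤ d) (b : Fin d → ℝ), Antitone b → (∀ i, 0 < b i) →
        metricEntropy 1 (ellipsoid b) ≤
          ((logVolumeLargeAxes b + c * (Real.log d +
            Real.sqrt (Real.log (b ⟨0, by omega⟩) * numLargeAxes b * Real.log d)) : ℝ) : EReal) := by
  refine ⟨26, by norm_num, fun d hd b hanti hb => ?_⟩
  set b₀ := b ⟨0, by omega⟩
  have hb₀ : ∀ i, b i ≤ b₀ := fun i => hanti (Fin.mk_le_of_le_val (Nat.zero_le _))
  have hd2 : (2 : ℝ) ≤ d := by exact_mod_cast hd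
  have hlog : 0 < Real.log d := Real.log_pos (by linarith)
  rcases le_or_gt b₀ 1 with h | h
  · have hm : numLargeAxes b = 0 := by
      rw [numLargeAxes, Finset.card_eq_zero, Finset.filter_eq_empty_iff]
      exact fun i _ => not_lt.2 ((hb₀ i).trans h)
    -- With no large axis, `L = 0` and any `δ` works.
    refine (metricEntropy_ellipsoid_le hd b hb le_rfl (fun i =>
      Real.log_nonpos (hb i).le ((hb₀ i).trans h)) one_pos).trans (EReal.coe_le_coe_iff.2 ?_)
    simp [hm]
  · have hL : 0 < Real.log b₀ := Real.log_pos h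
    have hm : (0 : ℝ) < numLargeAxes b := by
      rw [Nat.cast_pos, numLargeAxes, Finset.card_pos]
      exact ⟨⟨0, by omega⟩, by simpa using h⟩
    set L := Real.log b₀
    set m : ℝ := (numLargeAxes b : ℝ)
    set s := √(L * m * Real.log d)
    have hs : 0 < s := Real.sqrt_pos.2 (by positivity)
    have hs2 : s * s = L * m * Real.log d := Real.mul_self_sqrt (by positivity)
    -- With `δ = s / m`, both `m δ` and `(L/δ) ln d` equal `s`.
    refine (metricEntropy_ellipsoid_le hd b hb hL.le (fun i =>
      Real.log_le_log (hb i) (hb₀ i)) (div_pos hs hm)).trans (EReal.coe_le_coe_iff.2 ?_)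
    have h1 : m * (s / m) = s := by field_simp
    have h2 : L / (s / m) * Real.log d = s := by
      rw [div_div_eq_mul_div, div_mul_eq_mul_div, div_eq_iff hs.ne']
      exact hs2.symm
    change logVolumeLargeAxes b + m * (s / m) + (26 + 12 * (L / (s / m))) * Real.log d ≤ _
    rw [h1]
    linarith
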